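/- Let $n\ge 2$. Permutations are multiplied from left to right, i.e. $(\pi\sigma)(i)=\sigma(\pi(i))$. Let $D_n$ be the Coxeter group of type $D$, realised as the group of even signed permutations of $\{\pm1,\dots,\pm n\}$ (bijections $\pi$ with $\pi(-i)=-\pi(i)$ and an even number of negative values among $\pi(1),\dots,\pi(n)$), with Coxeter generators $s_i$ ($1\le i\le n-1$), exchanging $i\leftrightarrow i+1$ and $-i\leftrightarrow-(i+1)$, and $s_{1'}$, exchanging $1\leftrightarrow-2$ and $2\leftrightarrow-1$. Put $t_k=s_1s_2\cdots s_{k-1}$ for $2\le k\le n$ and $w_k=s_ks_{k-1}\cdots s_1\cdot s_{1'}\cdot s_2s_3\cdots s_k$ for $1\le k\le n-1$. In the symmetric group $S_n$ write likewise $s_i=(i,\,i+1)$ and $t_k=s_1\cdots s_{k-1}$, and for $\sigma\in S_n$ let $\mathrm{maj}(\sigma)=\sum_{\sigma(i)>\sigma(i+1)}i$. Let $\Phi:D_n\to S_n$ be the homomorphism $\pi\mapsto\pi'$ with $\pi'(j)=|\pi(j)|$ (so $\Phi(s_i)=s_i$, $\Phi(s_{1'})=s_1$). A standard OGS elementary element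 of $S_n$ is an element $t_{k_1}^{i_1}\cdots t_{k_m}^{i_m}$ with $m\ge1$, $2\le k_1<\cdots<k_m\le n$, $0<i_j<k_j$ and $i_1+\cdots+i_m\le k_1$. A standard OGS elementary factorization of $\sigma\in S_n$ is a factorization $\sigma=\sigma_1\cdots\sigma_z$ into elementary elements $\sigma_v=t_{h_{v,1}}^{i_{v,1}}\cdots t_{h_{v,m_v}}^{i_{v,m_v}}$ (written in the above form) with $h_{v-1,m_{v-1}}\le\sum_j i_{v,j}\ (\le h_{v,1})$ for $2\le v\le z$ and with $z$ minimal among all such factorizations (the identity has $z=0$). **Theorem.** Let $\pi$ be an element of the parabolic subgroup $\langle s_{1'},s_2,\dots,s_{n-1}\rangle$ of $D_n$. Then $\pi'$ has a standard OGS elementary factorization, and for every standard OGS elementary factorization $\pi'=\pi'_1\cdots\pi'_z$, with $\pi'_v=t_{h_{v,1}}^{i_{v,1}}\cdots t_{h_{v,m_v}}^{i_{v,m_v}}$, the following holds. For every $v$ one has $\mathrm{maj}(\pi'_v)\le h_{v,1}$, and $$\pi=\pi_1\cdot\pi_2\cdots\pi_z,\qquad \pi_v=\begin{cases}t_{h_{v,1}}^{i_{v,1}}\cdots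 t_{h_{v,m_v}}^{i_{v,m_v}} & \text{if }\mathrm{maj}(\pi'_v)=h_{v,1},\\ w_{\mathrm{maj}(\pi'_v)}\cdot t_{h_{v,1}}^{i_{v,1}}\cdots t_{h_{v,m_v}}^{i_{v,m_v}} & \text{if }\mathrm{maj}(\pi'_v)<h_{v,1},\end{cases}$$ the products being taken in $D_n$. Moreover this gives the generalized standard OGS presentation of $\pi$: $$\pi=w_1^{j_1}t_2^{i_2}w_2^{j_2}t_3^{i_3}\cdots w_{n-1}^{j_{n-1}}t_n^{i_n},\qquad 0\le i_k\le k-1,\quad 0\le j_k\le1,$$ where $i_k$ is the sum of all exponents $i_{v,u}$ with $h_{v,u}=k$ and $j_k$ is the number of $v$ with $\mathrm{maj}(\pi'_v)=k<h_{v,1}$. -/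

import Mathlib

namespace StandardOGS

/-- Permutations of `α`, multiplied from left to right: `(π * σ).unop i = σ.unop (π.unop i)`. -/
abbrev LPerm (α : Type) : Type := (Equiv.Perm α)ᵐᵒᵖ

/-- The symmetric group `S_n`: the permutations of `{1, …, n}`, written as the permutations of `ℕ`
that fix every number outside `{1, …, n}`. -/
def symGroup (n : ℕ) : Subgroup (LPerm ℕ) where
  carrier := {π | ∀ i : ℕ, i ∉ Finset.Icc 1 n → π.unop i = i}
  one_mem' := by intro i _; rfl
  mul_mem' := by
    intro a b ha hb i hi
    simp only [MulOpposite.unop_mul, Equiv.Perm.mul_apply]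
    rw [ha i hi, hb i hi]
  inv_mem' := by
    intro a ha i hi
    simp only [MulOpposite.unop_inv]
    rw [Equiv.Perm.inv_eq_iff_eq]
    exact (ha i hi).symm

/-- The sign `±1` of an integer, with value `1` at `0`. -/
def sgn (x : ℤ) : ℤˣ := if x < 0 then -1 else 1

theorem sgn_neg {x : ℤ} (hx : x ≠ 0) : sgn (-x) = -sgn x := by
  unfold sgn
  rcases lt_trichotomy x 0 with h | h | h
  · simp [h, h.le]
  · exact absurd h hx
  · simp [h, h.le]

/-- The signed permutations of `{±1, …, ±n}`, written as the odd permutations of `ℤ` that fix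
every integer of absolute value larger than `n` (the group `B_n`). -/
def signedGroup (n : ℕ) : Subgroup (LPerm ℤ) where
  carrier := {π | (∀ i : ℤ, π.unop (-i) = -π.unop i) ∧ ∀ i : ℤ, (n : ℤ) < |i| → π.unop i = i}
  one_mem' := ⟨fun _ => rfl, fun _ _ => rfl⟩
  mul_mem' := by
    rintro a b ⟨ha, ha'⟩ ⟨hb, hb'⟩
    refine ⟨fun i => ?_, fun i hi => ?_⟩
    · simp only [MulOpposite.unop_mul, Equiv.Perm.mul_apply]
      rw [ha, hb]
    · simp only [MulOpposite.unop_mul, Equiv.Perm.mul_apply]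
      rw [ha' i hi, hb' i hi]
  inv_mem' := by
    rintro a ⟨ha, ha'⟩
    refine ⟨fun i => ?_, fun i hi => ?_⟩
    · simp only [MulOpposite.unop_inv]
      rw [Equiv.Perm.inv_eq_iff_eq, ha]
      simp
    · simp only [MulOpposite.unop_inv]
      rw [Equiv.Perm.inv_eq_iff_eq]
      exact (ha' i hi).symm

theorem signed_zero {n : ℕ} {π : LPerm ℤ} (h : π ∈ signedGroup n) : π.unop 0 = 0 := by
  have := h.1 0
  simp only [neg_zero] at this
  omega

theorem signed_ne_zero {n : ℕ} {π : LPerm ℤ} (h : π ∈ signedGroup n) {x : ℤ} (hx : x ≠ 0) :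
    π.unop x ≠ 0 := by
  intro h0
  apply hx
  apply π.unop.injective
  rw [h0, signed_zero h]

/-- `|π|x|| = |π x|` for a signed permutation. -/
theorem signed_natAbs {n : ℕ} {π : LPerm ℤ} (h : π ∈ signedGroup n) (x : ℤ) :
    (π.unop (x.natAbs : ℤ)).natAbs = (π.unop x).natAbs := by
  rcases Int.natAbs_eq x with hx | hx
  · rw [← hx]
  · have : ((x.natAbs : ℕ) : ℤ) = -x := by omega
    rw [this, h.1, Int.natAbs_neg]

/-- The permutation `j ↦ |π(j)|` of `ℕ` given by a signed permutation `π`. -/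
def absPerm {n : ℕ} (π : signedGroup n) : Equiv.Perm ℕ where
  toFun j := (π.1.unop (j : ℤ)).natAbs
  invFun j := ((π⁻¹).1.unop (j : ℤ)).natAbs
  left_inv j := by
    change ((π⁻¹).1.unop ((π.1.unop (j : ℤ)).natAbs : ℤ)).natAbs = j
    rw [signed_natAbs (π⁻¹).2]
    simp
  right_inv j := by
    change (π.1.unop (((π⁻¹).1.unop (j : ℤ)).natAbs : ℤ)).natAbs = j
    rw [signed_natAbs π.2]
    simp

/-- The homomorphism `π ↦ (j ↦ |π(j)|)` from signed permutations to permutations. -/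
def absHom (n : ℕ) : signedGroup n →* symGroup n where
  toFun π := ⟨MulOpposite.op (absPerm π), by
    intro i hi
    change (π.1.unop (i : ℤ)).natAbs = i
    rcases Nat.eq_zero_or_pos i with h0 | h0
    · subst h0
      rw [Nat.cast_zero, signed_zero π.2]
      rfl
    · have hi' : n < i := by
        simp only [Finset.mem_Icc] at hi
        omega
      rw [π.2.2 i (by simpa using hi')]
      simp⟩
  map_one' := by
    ext1
    apply MulOpposite.unop_injective
    ext j
    rfl
  map_mul' a b := by
    ext1
    apply MulOpposite.unop_injective
    ext j
    change (b.1.unop (a.1.unop (j : ℤ))).natAbs = (b.1.unop ((a.1.unop (j : ℤ)).natAbs : ℤ)).natAbs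
    rw [signed_natAbs b.2]

/-- The number of negative entries of `[π(1); …; π(n)]`. -/
def negCount (n : ℕ) (π : LPerm ℤ) : ℕ :=
  ((Finset.Icc 1 n).filter fun i : ℕ => π.unop (i : ℤ) < 0).card

theorem neg_one_pow_negCount (n : ℕ) (π : LPerm ℤ) :
    (-1 : ℤˣ) ^ negCount n π = ∏ i ∈ Finset.Icc 1 n, sgn (π.unop (i : ℤ)) := by
  unfold negCount sgn
  rw [Finset.prod_ite]
  simp

theorem sgn_mul_apply {n : ℕ} {a b : LPerm ℤ} (ha : a ∈ signedGroup n) (hb : b ∈ signedGroup n)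
    {i : ℕ} (hi : 1 ≤ i) :
    sgn ((a * b).unop (i : ℤ)) =
      sgn (a.unop (i : ℤ)) * sgn (b.unop ((a.unop (i : ℤ)).natAbs : ℤ)) := by
  have h0 : a.unop (i : ℤ) ≠ 0 := signed_ne_zero ha (by omega)
  simp only [MulOpposite.unop_mul, Equiv.Perm.mul_apply]
  rcases lt_or_ge (a.unop (i : ℤ)) 0 with h | h
  · have e : ((a.unop (i : ℤ)).natAbs : ℤ) = -a.unop (i : ℤ) := by omega
    rw [e, hb.1, sgn_neg (signed_ne_zero hb h0)]
    have h1 : sgn (a.unop (i : ℤ)) = -1 := by simp [sgn, h]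
    rw [h1, neg_one_mul, neg_neg]
  · have e : ((a.unop (i : ℤ)).natAbs : ℤ) = a.unop (i : ℤ) := by omega
    rw [e]
    simp [sgn, not_lt.mpr h]

theorem neg_one_pow_negCount_mul {n : ℕ} {a b : LPerm ℤ} (ha : a ∈ signedGroup n)
    (hb : b ∈ signedGroup n) :
    (-1 : ℤˣ) ^ negCount n (a * b) = (-1) ^ negCount n a * (-1) ^ negCount n b := by
  simp only [neg_one_pow_negCount]
  rw [Finset.prod_congr rfl fun i hi => sgn_mul_apply ha hb (Finset.mem_Icc.mp hi).1,
    Finset.prod_mul_distrib]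
  congr 1
  have key : ∀ c : signedGroup n, ∀ i ∈ Finset.Icc 1 n, absPerm c i ∈ Finset.Icc 1 n := by
    intro c i hi
    by_contra hc
    have h1 := (absHom n c).2 _ hc
    exact hc (((absPerm c).injective h1).symm ▸ hi)
  refine Finset.prod_bij' (fun i _ => absPerm ⟨a, ha⟩ i) (fun i _ => (absPerm ⟨a, ha⟩).symm i)
    (fun i hi => key _ i hi) (fun i hi => key (⟨a, ha⟩⁻¹) i hi) ?_ ?_ ?_
  · intro i _; simp
  · intro i _; simp
  · intro i _; rfl

/-- The Coxeter group `D_n`, as the group of even signed permutations: the signed permutations `π`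
of `{±1, …, ±n}` for which `[π(1); …; π(n)]` has an even number of negative entries. -/
def evenSignedGroup (n : ℕ) : Subgroup (LPerm ℤ) where
  carrier := {π | π ∈ signedGroup n ∧ Even (negCount n π)}
  one_mem' := by
    refine ⟨one_mem _, ?_⟩
    have : negCount n 1 = 0 := by
      unfold negCount
      rw [Finset.card_eq_zero, Finset.filter_eq_empty_iff]
      intro i _
      change ¬ ((i : ℤ) < 0)
      omega
    rw [this]
    exact Even.zero
  mul_mem' := by
    rintro a b ⟨ha, ha'⟩ ⟨hb, hb'⟩
    refine ⟨mul_mem ha hb, ?_⟩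
    have h := neg_one_pow_negCount_mul ha hb
    rw [ha'.neg_one_pow, hb'.neg_one_pow, one_mul] at h
    rcases Nat.even_or_odd (negCount n (a * b)) with h2 | h2
    · exact h2
    · rw [h2.neg_one_pow] at h
      exact absurd h (by decide)
  inv_mem' := by
    rintro a ⟨ha, ha'⟩
    refine ⟨inv_mem ha, ?_⟩
    have h := neg_one_pow_negCount_mul ha (inv_mem ha)
    have h1 : (-1 : ℤˣ) ^ negCount n (1 : LPerm ℤ) = 1 := by
      rw [neg_one_pow_negCount]
      refine Finset.prod_eq_one fun i _ => ?_
      change sgn (i : ℤ) = 1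
      simp [sgn]
    rw [mul_inv_cancel, h1, ha'.neg_one_pow, one_mul] at h
    rcases Nat.even_or_odd (negCount n a⁻¹) with h2 | h2
    · exact h2
    · rw [h2.neg_one_pow] at h
      exact absurd h (by decide)

theorem evenSignedGroup_le (n : ℕ) : evenSignedGroup n ≤ signedGroup n := fun _ h => h.1

/-- The natural homomorphism `Φ : D_n → S_n`, `π ↦ π'`, with `π'(j) = |π(j)|`. -/
def Phi (n : ℕ) : evenSignedGroup n →* symGroup n :=
  (absHom n).comp (Subgroup.inclusion (evenSignedGroup_le n))

/-- The Coxeter generator `s_i = (i, i+1)` of `S_n`, for `1 ≤ i ≤ n - 1`. -/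
def sSym (i : ℕ) : LPerm ℕ := MulOpposite.op (Equiv.swap i (i + 1))

/-- The Coxeter generator `s_i` of `D_n`, for `1 ≤ i ≤ n - 1`: it exchanges `i` with `i + 1` and
`-i` with `-(i+1)`. -/
def s (i : ℕ) : LPerm ℤ :=
  MulOpposite.op (Equiv.swap (i : ℤ) (i + 1) * Equiv.swap (-(i : ℤ)) (-(i + 1)))

/-- The Coxeter generator `s_{1'}` of `D_n`: it exchanges `1` with `-2` and `2` with `-1`. -/
def sPrime : LPerm ℤ := MulOpposite.op (Equiv.swap 1 (-2) * Equiv.swap 2 (-1))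

theorem s_apply {i : ℕ} (hi : 1 ≤ i) (x : ℤ) : (s i).unop x =
    if x = i then (i : ℤ) + 1 else if x = i + 1 then (i : ℤ) else
      if x = -i then -((i : ℤ) + 1) else if x = -(i + 1) then -(i : ℤ) else x := by
  simp only [s, MulOpposite.unop_op, Equiv.Perm.mul_apply, Equiv.swap_apply_def]
  split_ifs <;> first | rfl | omega

theorem sPrime_apply (x : ℤ) : sPrime.unop x =
    if x = 1 then -2 else if x = 2 then -1 else if x = -1 then 2 else if x = -2 then 1 else x := by
  simp only [sPrime, MulOpposite.unop_op, Equiv.Perm.mul_apply, Equiv.swap_apply_def]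
  split_ifs <;> first | omega | contradiction

theorem s_mem {n i : ℕ} (hi : 1 ≤ i) (hn : i ≤ n - 1) : s i ∈ evenSignedGroup n := by
  refine ⟨⟨fun x => ?_, fun x hx => ?_⟩, ?_⟩
  · rw [s_apply hi, s_apply hi]
    split_ifs <;> omega
  · rw [s_apply hi]
    have := lt_abs.mp hx
    split_ifs <;> omega
  · have : negCount n (s i) = 0 := by
      unfold negCount
      rw [Finset.card_eq_zero, Finset.filter_eq_empty_iff]
      intro j hj
      rw [s_apply hi]
      have := (Finset.mem_Icc.mp hj).1
      split_ifs <;> omega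
    rw [this]
    exact Even.zero

theorem sPrime_mem {n : ℕ} (hn : 2 ≤ n) : sPrime ∈ evenSignedGroup n := by
  refine ⟨⟨fun x => ?_, fun x hx => ?_⟩, ?_⟩
  · rw [sPrime_apply, sPrime_apply]
    split_ifs <;> omega
  · rw [sPrime_apply]
    have := lt_abs.mp hx
    split_ifs <;> omega
  · have : (Finset.Icc 1 n).filter (fun i : ℕ => sPrime.unop (i : ℤ) < 0) = {1, 2} := by
      ext j
      rw [Finset.mem_filter, Finset.mem_Icc, sPrime_apply, Finset.mem_insert,
        Finset.mem_singleton]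
      split_ifs <;> constructor <;> intro h <;> omega
    unfold negCount
    rw [this]
    decide

/-- `Φ(s_i) = s_i`. -/
theorem Phi_s {n i : ℕ} (hi : 1 ≤ i) (hn : i ≤ n - 1) :
    (Phi n ⟨s i, s_mem hi hn⟩ : LPerm ℕ) = sSym i := by
  apply MulOpposite.unop_injective
  ext j
  change ((s i).unop (j : ℤ)).natAbs = (sSym i).unop j
  rw [s_apply hi]
  simp only [sSym, MulOpposite.unop_op, Equiv.swap_apply_def]
  split_ifs <;> omega

/-- `Φ(s_{1'}) = s_1`. -/
theorem Phi_sPrime {n : ℕ} (hn : 2 ≤ n) :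
    (Phi n ⟨sPrime, sPrime_mem hn⟩ : LPerm ℕ) = sSym 1 := by
  apply MulOpposite.unop_injective
  ext j
  change (sPrime.unop (j : ℤ)).natAbs = (sSym 1).unop j
  rw [sPrime_apply]
  simp only [sSym, MulOpposite.unop_op, Equiv.swap_apply_def]
  split_ifs <;> first | omega | contradiction

/-- The element `t_k = s_1 s_2 ⋯ s_{k-1}` of `S_n`, for `2 ≤ k ≤ n`. -/
def tSym (k : ℕ) : LPerm ℕ := ((List.range (k - 1)).map fun j => sSym (j + 1)).prod

/-- The element `t_k = s_1 s_2 ⋯ s_{k-1}` of `D_n`, for `2 ≤ k ≤ n`. -/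
def t (k : ℕ) : LPerm ℤ := ((List.range (k - 1)).map fun j => s (j + 1)).prod

/-- The element `w_k = s_k s_{k-1} ⋯ s_1 · s_{1'} · s_2 s_3 ⋯ s_k` of `D_n`, for
`1 ≤ k ≤ n - 1`. -/
def w (k : ℕ) : LPerm ℤ :=
  ((List.range k).map fun j => s (k - j)).prod * sPrime *
    ((List.range (k - 1)).map fun j => s (j + 2)).prod

/-- The parabolic subgroup of `D_n` generated by `s_{1'}, s_2, …, s_{n-1}`. -/
def parabolic (n : ℕ) : Subgroup (LPerm ℤ) :=
  Subgroup.closure ({sPrime} ∪ {x | ∃ i : ℕ, 2 ≤ i ∧ i ≤ n - 1 ∧ x = s i})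

/-- The major index of `σ ∈ S_n`: the sum of the `1 ≤ i ≤ n - 1` with `σ(i) > σ(i+1)`. -/
def maj (n : ℕ) (σ : LPerm ℕ) : ℕ :=
  ∑ i ∈ (Finset.Icc 1 (n - 1)).filter (fun i => σ.unop i > σ.unop (i + 1)), i

/-- The list `L = [(k_1, i_1), …, (k_m, i_m)]` is a standard OGS canonical form
`t_{k_1}^{i_1} ⋯ t_{k_m}^{i_m}` in `S_n` with non-zero exponents:
`2 ≤ k_1 < ⋯ < k_m ≤ n` and `0 < i_j < k_j`. -/
def IsCanonicalForm (n : ℕ) (L : List (ℕ × ℕ)) : Prop :=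
  L.Pairwise (fun p q => p.1 < q.1) ∧ ∀ p ∈ L, 2 ≤ p.1 ∧ p.1 ≤ n ∧ 0 < p.2 ∧ p.2 < p.1

/-- `i_1 + ⋯ + i_m`. -/
def expSum (L : List (ℕ × ℕ)) : ℕ := (L.map Prod.snd).sum

/-- The first index `k_1` (of a non-empty list). -/
def firstIdx (L : List (ℕ × ℕ)) : ℕ := (L.headD (0, 0)).1

/-- The last index `k_m` (of a non-empty list). -/
def lastIdx (L : List (ℕ × ℕ)) : ℕ := (L.getLastD (0, 0)).1

/-- `t_{k_1}^{i_1} ⋯ t_{k_m}^{i_m}` as an element of `S_n`. -/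
def evalSym (L : List (ℕ × ℕ)) : LPerm ℕ := (L.map fun p => tSym p.1 ^ p.2).prod

/-- `t_{k_1}^{i_1} ⋯ t_{k_m}^{i_m}` as an element of `D_n`. -/
def eval (L : List (ℕ × ℕ)) : LPerm ℤ := (L.map fun p => t p.1 ^ p.2).prod

/-- `L` is the canonical form of a standard OGS elementary element of `S_n`:
`i_1 + ⋯ + i_m ≤ k_1`, with `m ≥ 1`. -/
def IsElementary (n : ℕ) (L : List (ℕ × ℕ)) : Prop :=
  L ≠ [] ∧ IsCanonicalForm n L ∧ expSum L ≤ firstIdx L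

/-- `σ = σ_1 ⋯ σ_z` where each `σ_v`, given by its canonical form, the `v`-th member of `F`, is
standard OGS elementary, and, for `v ≥ 2`, the sum of the exponents of `σ_v` is at least the last
index of `σ_{v-1}`. -/
def IsElementaryProduct (n : ℕ) (σ : LPerm ℕ) (F : List (List (ℕ × ℕ))) : Prop :=
  (∀ L ∈ F, IsElementary n L) ∧
    (∀ v : ℕ, ∀ h : v + 1 < F.length, lastIdx F[v] ≤ expSum F[v + 1]) ∧
    σ = (F.map evalSym).prod

/-- `F` is a standard OGS elementary factorization of `σ`: a product as above with the minimal
number `z(σ)` of factors. -/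
def IsStandardFactorization (n : ℕ) (σ : LPerm ℕ) (F : List (List (ℕ × ℕ))) : Prop :=
  IsElementaryProduct n σ F ∧ ∀ G, IsElementaryProduct n σ G → F.length ≤ G.length

/-- The factor `π_v` of `D_n` that belongs to the factor `π'_v` of `S_n` with canonical form `L`:
`w_{maj(π'_v)} · π'_v` if `maj(π'_v) < h_{v,1}`, and `π'_v` otherwise. -/
def factor (n : ℕ) (L : List (ℕ × ℕ)) : LPerm ℤ :=
  if maj n (evalSym L) < firstIdx L then w (maj n (evalSym L)) * eval L else eval L

/-- `π = w_1^{j_1} t_2^{i_2} w_2^{j_2} t_3^{i_3} ⋯ w_{n-1}^{j_{n-1}} t_n^{i_n}` is the generalized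
standard OGS presentation of `π ∈ D_n`: `0 ≤ i_k ≤ k - 1` and `0 ≤ j_k ≤ 1`. -/
def IsGeneralizedOGS (n : ℕ) (i j : ℕ → ℕ) (π : LPerm ℤ) : Prop :=
  (∀ k, 2 ≤ k → k ≤ n → i k ≤ k - 1) ∧ (∀ k, 1 ≤ k → k ≤ n - 1 → j k ≤ 1) ∧
    π = ((List.range (n - 1)).map fun r => w (r + 1) ^ j (r + 1) * t (r + 2) ^ i (r + 2)).prod

/-- The total exponent of `t_k` in the factors listed by `F`. -/
def tExp (F : List (List (ℕ × ℕ))) (k : ℕ) : ℕ :=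
  expSum (F.flatten.filter fun p => p.1 = k)

/-- The number of factors listed by `F` that contribute the letter `w_k`: those with
`maj(π'_v) = k < h_{v,1}`. -/
def wExp (n : ℕ) (F : List (List (ℕ × ℕ))) (k : ℕ) : ℕ :=
  F.countP fun L => maj n (evalSym L) = k ∧ k < firstIdx L

end StandardOGS

namespace StandardOGS

/-! Let `c = signFlip 1` be the sign change of `1`, an element of `B_n` outside `D_n`. Conjugation
by `c` swaps `s_1` with `s_{1'}` and fixes `s_i` for `i ≥ 2`, so an element `π` of the parabolic
subgroup is `c a c`, with `a` the odd extension of `π'` (`isLift_Phi`). Any factorization of `π'`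
thus gives one of `π` into the conjugates `c a_v c` of the lifted factors (`prod_factor`).

An elementary element with exponent sum `e` and first index `h` has its only descent at `e`, so its
major index is `e` (`IsElementary.maj_evalSym`). If `e < h` it sends `e + 1` to `1`; moving the
right-hand `c` across it gives the sign change of `e + 1`, and the two sign changes multiply to
`w_e` (`w_eq`). If `e = h` it fixes `1` and commutes with `c`. This is `IsElementary.factor_eq`.

The inequalities between neighbouring factors put the letters in the order `w_1, t_2, w_2, t_3, …`
(`prod_factor_eq_ogsProd`). A letter `t_k` can be shared by two neighbours only; were its exponents
to add up to at least `k`, the two factors would merge (`exists_merge`), against minimality. Hence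
`i_k ≤ k - 1`. -/

theorem unop_mul_apply {α : Type} (a b : LPerm α) (x : α) :
    (a * b).unop x = b.unop (a.unop x) := rfl

theorem lperm_ext {α : Type} {a b : LPerm α} (h : ∀ x, a.unop x = b.unop x) : a = b :=
  MulOpposite.unop_injective (Equiv.ext h)

/-! ### The powers of `t_k` in `S_n` -/

theorem tSym_succ {k : ℕ} (hk : 1 ≤ k) : tSym (k + 1) = tSym k * sSym k := by
  obtain ⟨k, rfl⟩ := Nat.exists_eq_add_of_le' hk
  simp [tSym, List.range_succ]

theorem tSym_apply {k : ℕ} (hk : 1 ≤ k) (x : ℕ) :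
    (tSym k).unop x = if x = 1 then k else if 2 ≤ x ∧ x ≤ k then x - 1 else x := by
  induction k, hk using Nat.le_induction generalizing x with
  | base =>
    simp only [tSym, le_refl, tsub_eq_zero_of_le, List.range_zero, List.map_nil, List.prod_nil,
      MulOpposite.unop_one, Equiv.Perm.coe_one, id_eq]
    split_ifs <;> omega
  | succ k hk ih =>
    rw [tSym_succ hk, unop_mul_apply, ih]
    simp only [sSym, MulOpposite.unop_op, Equiv.swap_apply_def]
    split_ifs <;> omega

/-- `t_k` is the cyclic shift `x ↦ x - 1` of `1, …, k`. Allowing `i = k` makes `t_k ^ k = 1` a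
special case. -/
theorem tSym_pow_apply {k i : ℕ} (hk : 1 ≤ k) (hi : i ≤ k) (x : ℕ) :
    (tSym k ^ i).unop x =
      if x = 0 ∨ k < x then x else if x ≤ i then k - i + x else x - i := by
  induction i with
  | zero =>
    simp only [pow_zero, MulOpposite.unop_one, Equiv.Perm.coe_one, id_eq]
    split_ifs <;> omega
  | succ i ih =>
    rw [pow_succ, unop_mul_apply, ih (by omega), tSym_apply hk]
    split_ifs <;> omega

theorem tSym_pow_self {k : ℕ} (hk : 1 ≤ k) : tSym k ^ k = 1 := by
  refine lperm_ext fun x => ?_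
  rw [tSym_pow_apply hk le_rfl]
  simp only [MulOpposite.unop_one, Equiv.Perm.coe_one, id_eq]
  split_ifs <;> omega

/-! ### Lists of indices and exponents -/

@[simp] theorem expSum_nil : expSum [] = 0 := rfl

@[simp] theorem expSum_cons (p : ℕ × ℕ) (L : List (ℕ × ℕ)) :
    expSum (p :: L) = p.2 + expSum L := by simp [expSum]

@[simp] theorem expSum_append (L M : List (ℕ × ℕ)) :
    expSum (L ++ M) = expSum L + expSum M := by simp [expSum]

@[simp] theorem evalSym_nil : evalSym [] = 1 := rfl

@[simp] theorem evalSym_cons (p : ℕ × ℕ) (L : List (ℕ × ℕ)) :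
    evalSym (p :: L) = tSym p.1 ^ p.2 * evalSym L := by simp [evalSym]

@[simp] theorem evalSym_append (L M : List (ℕ × ℕ)) :
    evalSym (L ++ M) = evalSym L * evalSym M := by simp [evalSym]

@[simp] theorem firstIdx_cons (p : ℕ × ℕ) (L : List (ℕ × ℕ)) : firstIdx (p :: L) = p.1 := rfl

theorem IsCanonicalForm.tail {n : ℕ} {p : ℕ × ℕ} {L : List (ℕ × ℕ)}
    (h : IsCanonicalForm n (p :: L)) : IsCanonicalForm n L :=
  ⟨(List.pairwise_cons.mp h.1).2, fun q hq => h.2 q (List.mem_cons_of_mem p hq)⟩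

theorem IsCanonicalForm.firstIdx_le {n : ℕ} {L : List (ℕ × ℕ)} (h : IsCanonicalForm n L)
    {p : ℕ × ℕ} (hp : p ∈ L) : firstIdx L ≤ p.1 := by
  cases L with
  | nil => simp at hp
  | cons q L =>
    rcases List.mem_cons.mp hp with rfl | hp
    · rfl
    · exact ((List.pairwise_cons.mp h.1).1 p hp).le

theorem IsCanonicalForm.le_lastIdx {n : ℕ} {L : List (ℕ × ℕ)} (h : IsCanonicalForm n L)
    {p : ℕ × ℕ} (hp : p ∈ L) : p.1 ≤ lastIdx L := by
  rcases List.eq_nil_or_concat L with rfl | ⟨A, q, rfl⟩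
  · simp at hp
  · have h1 := h.1
    simp only [List.concat_eq_append, List.pairwise_append, List.mem_append,
      List.mem_singleton] at hp h1 ⊢
    rcases hp with hp | rfl
    · simpa [lastIdx] using (h1.2.2 p hp q rfl).le
    · simp [lastIdx]

theorem IsElementary.firstIdx_le_lastIdx {n : ℕ} {L : List (ℕ × ℕ)} (h : IsElementary n L) :
    firstIdx L ≤ lastIdx L := by
  obtain ⟨h0, h1, -⟩ := h
  cases L with
  | nil => exact absurd rfl h0
  | cons p L => exact h1.le_lastIdx (List.mem_cons_self ..)

theorem IsElementary.expSum_pos {n : ℕ} {L : List (ℕ × ℕ)} (h : IsElementary n L) :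
    0 < expSum L := by
  obtain ⟨h0, h1, -⟩ := h
  cases L with
  | nil => exact absurd rfl h0
  | cons p L =>
    have := h1.2 p (List.mem_cons_self ..)
    rw [expSum_cons]
    omega

/-- Strict for a single letter because `i_1 < k_1`, and otherwise because `k_1 < k_m`. -/
theorem IsElementary.expSum_lt_lastIdx {n : ℕ} {L : List (ℕ × ℕ)} (h : IsElementary n L) :
    expSum L < lastIdx L := by
  obtain ⟨h0, h1, h2⟩ := h
  rcases L with _ | ⟨p, _ | ⟨q, L⟩⟩
  · exact absurd rfl h0
  · have := h1.2 p (List.mem_cons_self ..)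
    simp only [expSum_cons, expSum_nil, lastIdx, List.getLastD_cons, List.getLastD_nil]
    omega
  · have a := (List.pairwise_cons.mp h1.1).1 q (List.mem_cons_self ..)
    have b := h1.le_lastIdx (p := q) (by simp)
    rw [firstIdx_cons] at h2
    omega

theorem IsElementary.lastIdx_le {n : ℕ} {L : List (ℕ × ℕ)} (h : IsElementary n L) :
    lastIdx L ≤ n := by
  obtain ⟨h0, h1, -⟩ := h
  rcases List.eq_nil_or_concat L with rfl | ⟨A, q, rfl⟩
  · exact absurd rfl h0
  · simpa [lastIdx] using (h1.2 q (by simp)).2.1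

/-! ### Elementary elements of `S_n` have a single descent -/

/-- `τ` is increasing on `1, …, e` and on `e + 1, e + 2, …`, and its restriction to
`e + 1, …, k` is the order isomorphism onto `1, …, k - e`. -/
structure IsShuffle (τ : LPerm ℕ) (e k : ℕ) : Prop where
  low : ∀ j, 1 ≤ j → e + j ≤ k → τ.unop (e + j) = j
  high : ∀ j, 1 ≤ j → j ≤ e → k < τ.unop j + e
  mono_left : ∀ j, 1 ≤ j → j < e → τ.unop j < τ.unop (j + 1)
  mono_right : ∀ j, e < j → τ.unop j < τ.unop (j + 1)

theorem isShuffle_one (k : ℕ) : IsShuffle 1 0 k where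
  low j _ _ := by simp
  high j _ _ := by omega
  mono_left j _ _ := by omega
  mono_right j _ := by simp

section

variable {τ : LPerm ℕ} {e k k' i : ℕ}

theorem unop_tSym_pow_mul (hik : i < k) (τ : LPerm ℕ) (x : ℕ) :
    (tSym k ^ i * τ).unop x =
      τ.unop (if x = 0 ∨ k < x then x else if x ≤ i then k - i + x else x - i) := by
  rw [unop_mul_apply, tSym_pow_apply (by omega) hik.le]

theorem IsShuffle.low' (h : IsShuffle τ e k) {j : ℕ} (h1 : e < j) (h2 : j ≤ k) :
    τ.unop j = j - e := by
  have := h.low (j - e) (by omega) (by omega)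
  rwa [Nat.add_sub_cancel' h1.le] at this

/-- The rotation brings the values at positions `k - i + 1, …, k` to the front and shifts those at
`1, …, k - i` right by `i`. Since `i + e ≤ k`, the values brought forward are small ones, at most `k
- e`, and they land before the `e` large ones, which exceed `k' - e`. -/
theorem IsShuffle.cons (h : IsShuffle τ e k') (hk : k < k') (hi : 0 < i) (hik : i < k)
    (hle : i + e ≤ k) : IsShuffle (tSym k ^ i * τ) (i + e) k where
  low j h1 h2 := by
    rw [unop_tSym_pow_mul hik, if_neg (by omega), if_neg (by omega), h.low' (by omega) (by omega)]
    omega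
  high j h1 h2 := by
    rw [unop_tSym_pow_mul hik, if_neg (by omega)]
    split_ifs
    · rw [h.low' (by omega) (by omega)]
      omega
    · have := h.high (j - i) (by omega) (by omega)
      omega
  mono_left j h1 h2 := by
    rw [unop_tSym_pow_mul hik, unop_tSym_pow_mul hik, if_neg (show ¬(j = 0 ∨ k < j) by omega),
      if_neg (show ¬(j + 1 = 0 ∨ k < j + 1) by omega)]
    rcases lt_trichotomy j i with hj | rfl | hj
    · rw [if_pos (by omega), if_pos (by omega), h.low' (by omega) (by omega),
        h.low' (by omega) (by omega)]
      omega
    -- The seam between the two blocks: `k - e` is followed by `τ(1) > k' - e`.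
    · rw [if_pos le_rfl, if_neg (by omega), h.low' (by omega) (by omega)]
      have := h.high (j + 1 - j) (by omega) (by omega)
      omega
    · rw [if_neg (by omega), if_neg (by omega)]
      have := h.mono_left (j - i) (by omega) (by omega)
      rwa [show j + 1 - i = j - i + 1 by omega]
  mono_right j h1 := by
    rw [unop_tSym_pow_mul hik, unop_tSym_pow_mul hik]
    rcases lt_trichotomy j k with hj | rfl | hj
    · rw [if_neg (by omega), if_neg (by omega), if_neg (by omega), if_neg (by omega),
        show j + 1 - i = j - i + 1 by omega]
      exact h.mono_right _ (by omega)
    -- The edge of the rotated interval; `k < k'` makes the value at `k + 1` still a small one.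
    · rw [if_neg (by omega), if_neg (by omega), if_pos (by omega), h.low' (by omega) (by omega),
        h.low' (by omega) (by omega)]
      omega
    · rw [if_pos (by omega), if_pos (by omega)]
      exact h.mono_right _ (by omega)

theorem IsShuffle.cons_descent (h : IsShuffle τ e k') (hk : k < k') (hi : 0 < i) (hik : i < k)
    (hle : i + e ≤ k) :
    (tSym k ^ i * τ).unop (i + e + 1) < (tSym k ^ i * τ).unop (i + e) := by
  -- If `i + e < k`, position `i + e + 1` carries `1`. If `i + e = k`, that position lies beyond the
  -- rotation and carries `k + 1 - e ≤ k' - e`, while position `k` carries `τ(e) > k' - e`.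
  rcases hle.lt_or_eq with hlt | heq
  · have h' := h.cons hk hi hik hle
    have h1 := h'.low 1 le_rfl (by omega)
    have h2 := h'.high (i + e) (by omega) le_rfl
    omega
  · rw [unop_tSym_pow_mul hik, unop_tSym_pow_mul hik, if_pos (by omega), if_neg (by omega),
      if_neg (by omega), h.low' (by omega) (by omega), Nat.add_sub_cancel_left]
    have := h.high e (by omega) le_rfl
    omega

theorem IsShuffle.cons_one (h : IsShuffle τ e k') (hk : k < k') (hi : 0 < i) (hik : i < k)
    (hle : i + e = k) : (tSym k ^ i * τ).unop 1 = 1 := by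
  rw [unop_tSym_pow_mul hik, if_neg (by omega), if_pos (by omega), h.low' (by omega) (by omega)]
  omega

end

/-- Stated for the tail, since the descent and the fixed point `1` are read off when the first
letter is prepended. For an empty tail any bound above `p.1` serves. -/
theorem IsElementary.exists_shuffle {n : ℕ} {p : ℕ × ℕ} {L : List (ℕ × ℕ)}
    (h : IsElementary n (p :: L)) : ∃ k', p.1 < k' ∧ IsShuffle (evalSym L) (expSum L) k' := by
  induction L generalizing p with
  | nil => exact ⟨p.1 + 1, by omega, isShuffle_one _⟩
  | cons q L ih =>
    obtain ⟨-, h1, h2⟩ := h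
    have hpq := (List.pairwise_cons.mp h1.1).1 q (List.mem_cons_self ..)
    have hq := h1.2 q (by simp)
    simp only [expSum_cons, firstIdx_cons] at h2
    obtain ⟨k', hk', hs⟩ := ih (p := q)
      ⟨by simp, h1.tail, by simp only [expSum_cons, firstIdx_cons]; omega⟩
    refine ⟨q.1, hpq, ?_⟩
    rw [evalSym_cons, expSum_cons]
    exact hs.cons hk' hq.2.2.1 hq.2.2.2 (by omega)

theorem IsElementary.isShuffle {n : ℕ} {L : List (ℕ × ℕ)} (h : IsElementary n L) :
    IsShuffle (evalSym L) (expSum L) (firstIdx L) ∧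
      (evalSym L).unop (expSum L + 1) < (evalSym L).unop (expSum L) ∧
      (expSum L = firstIdx L → (evalSym L).unop 1 = 1) := by
  cases L with
  | nil => exact absurd rfl h.1
  | cons p L =>
    obtain ⟨k', hk', hs⟩ := h.exists_shuffle
    have hp := (h.2.1.2 p (by simp)).2.2
    have h2 := h.2.2
    simp only [evalSym_cons, expSum_cons, firstIdx_cons] at h2 ⊢
    exact ⟨hs.cons hk' hp.1 hp.2 h2, hs.cons_descent hk' hp.1 hp.2 h2,
      hs.cons_one hk' hp.1 hp.2⟩

theorem IsElementary.maj_evalSym {n : ℕ} {L : List (ℕ × ℕ)} (h : IsElementary n L) :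
    maj n (evalSym L) = expSum L := by
  obtain ⟨hs, hd, -⟩ := h.isShuffle
  have h1 := h.expSum_pos
  have h2 := h.expSum_lt_lastIdx
  have h3 := h.lastIdx_le
  have : (Finset.Icc 1 (n - 1)).filter
      (fun i => (evalSym L).unop i > (evalSym L).unop (i + 1)) = {expSum L} := by
    ext j
    rw [Finset.mem_filter, Finset.mem_Icc, Finset.mem_singleton]
    constructor
    · rintro ⟨hj, hj'⟩
      rcases lt_trichotomy j (expSum L) with hlt | heq | hlt
      · exact absurd (hs.mono_left j hj.1 hlt) (by omega)
      · exact heq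
      · exact absurd (hs.mono_right j hlt) (by omega)
    · rintro rfl
      exact ⟨⟨h1, by omega⟩, hd⟩
  rw [maj, this, Finset.sum_singleton]

/-! ### Odd extensions of permutations and sign changes -/

/-- `a` is the odd extension of `b` to `ℤ`. -/
def IsLift (a : LPerm ℤ) (b : LPerm ℕ) : Prop :=
  ∀ j : ℕ, a.unop (j : ℤ) = b.unop j ∧ a.unop (-(j : ℤ)) = -(b.unop j : ℤ)

theorem isLift_one : IsLift 1 1 := fun j => by simp

theorem IsLift.mul {a a' : LPerm ℤ} {b b' : LPerm ℕ} (h : IsLift a b) (h' : IsLift a' b') :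
    IsLift (a * a') (b * b') := fun j => by
  simp only [unop_mul_apply, (h j).1, (h j).2, (h' _).1, (h' _).2, and_self]

theorem IsLift.inv {a : LPerm ℤ} {b : LPerm ℕ} (h : IsLift a b) : IsLift a⁻¹ b⁻¹ := fun j => by
  obtain ⟨i, rfl⟩ := b.unop.surjective j
  have hb : (b⁻¹).unop (b.unop i) = i := by simp
  rw [hb, MulOpposite.unop_inv, Equiv.Perm.inv_eq_iff_eq, Equiv.Perm.inv_eq_iff_eq]
  exact ⟨(h i).1.symm, (h i).2.symm⟩

theorem IsLift.pow {a : LPerm ℤ} {b : LPerm ℕ} (h : IsLift a b) (m : ℕ) :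
    IsLift (a ^ m) (b ^ m) := by
  induction m with
  | zero => simpa using isLift_one
  | succ m ih => simpa only [pow_succ] using ih.mul h

theorem isLift_list_prod {α : Type} {f : α → LPerm ℤ} {g : α → LPerm ℕ} (l : List α)
    (h : ∀ x ∈ l, IsLift (f x) (g x)) : IsLift (l.map f).prod (l.map g).prod := by
  induction l with
  | nil => exact isLift_one
  | cons x l ih =>
    simp only [List.map_cons, List.prod_cons]
    exact (h x (by simp)).mul (ih fun y hy => h y (by simp [hy]))

theorem IsLift.unique {a a' : LPerm ℤ} {b : LPerm ℕ} (h : IsLift a b) (h' : IsLift a' b) :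
    a = a' := by
  refine lperm_ext fun x => ?_
  rcases Int.natAbs_eq x with hx | hx <;> rw [hx]
  · rw [(h _).1, (h' _).1]
  · rw [(h _).2, (h' _).2]

theorem isLift_s {i : ℕ} (hi : 1 ≤ i) : IsLift (s i) (sSym i) := fun j => by
  rw [s_apply hi, s_apply hi]
  simp only [sSym, MulOpposite.unop_op, Equiv.swap_apply_def]
  constructor <;> split_ifs <;> omega

theorem isLift_t (k : ℕ) : IsLift (t k) (tSym k) :=
  isLift_list_prod _ fun _ _ => isLift_s (by omega)

theorem isLift_eval (L : List (ℕ × ℕ)) : IsLift (eval L) (evalSym L) :=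
  isLift_list_prod _ fun p _ => (isLift_t p.1).pow p.2

/-- The sign change `p ↔ -p`. -/
def signFlip (p : ℤ) : LPerm ℤ := MulOpposite.op (Equiv.swap p (-p))

theorem signFlip_mul_self (p : ℤ) : signFlip p * signFlip p = 1 := by
  rw [signFlip, ← MulOpposite.op_mul, Equiv.swap_mul_self, MulOpposite.op_one]

theorem signFlip_apply (p x : ℤ) :
    (signFlip p).unop x = if x = p then -p else if x = -p then p else x := by
  simp only [signFlip, MulOpposite.unop_op, Equiv.swap_apply_def]

/-- Conjugation by an odd map carries the transposition of `p, -p` to that of their images. -/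
theorem IsLift.signFlip_mul {a : LPerm ℤ} {b : LPerm ℕ} (h : IsLift a b) {p q : ℕ}
    (hpq : b.unop p = q) : signFlip p * a = a * signFlip q := by
  apply MulOpposite.unop_injective
  simp only [signFlip, MulOpposite.unop_mul, MulOpposite.unop_op]
  rw [Equiv.mul_swap_eq_swap_mul, (h p).1, (h p).2, hpq]

theorem s_mul_self {i : ℕ} (hi : 1 ≤ i) : s i * s i = 1 := by
  refine lperm_ext fun x => ?_
  rw [unop_mul_apply, s_apply hi, s_apply hi, MulOpposite.unop_one, Equiv.Perm.coe_one, id_eq]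
  split_ifs <;> omega

theorem w_succ {k : ℕ} (hk : 1 ≤ k) : w (k + 1) = s (k + 1) * w k * s (k + 1) := by
  obtain ⟨k, rfl⟩ := Nat.exists_eq_add_of_le' hk
  simp only [w, Nat.add_sub_cancel]
  rw [List.range_succ_eq_map (n := k + 1), List.range_succ (n := k)]
  simp [Function.comp_def, mul_assoc]

/-- `s_1 s_{1'}` changes the signs of `1` and `2`; conjugating by `s_{k+1}` fixes `1` and moves `k +
1` to `k + 2`. -/
theorem w_eq {k : ℕ} (hk : 1 ≤ k) : w k = signFlip 1 * signFlip (k + 1) := by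
  induction k, hk using Nat.le_induction with
  | base =>
    refine lperm_ext fun x => ?_
    have : w 1 = s 1 * sPrime := by simp [w]
    rw [this, unop_mul_apply, unop_mul_apply, s_apply le_rfl, sPrime_apply, signFlip_apply,
      signFlip_apply]
    push_cast
    split_ifs <;> first | omega | contradiction
  | succ k hk ih =>
    have hs := isLift_s (i := k + 1) (by omega)
    have h1 := hs.signFlip_mul (p := 1) (q := 1) (by
      rw [sSym, MulOpposite.unop_op, Equiv.swap_apply_of_ne_of_ne] <;> omega)
    have h2 := hs.signFlip_mul (p := k + 1) (q := k + 1 + 1) (by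
      rw [sSym, MulOpposite.unop_op, Equiv.swap_apply_left])
    push_cast at h1 h2 ⊢
    rw [w_succ hk, ih, ← mul_assoc, ← h1, mul_assoc, mul_assoc, h2, ← mul_assoc (s _),
      s_mul_self (by omega), one_mul]

/-- The factor of `D_n` attached to an elementary element is its conjugate by the sign change
of `1`. -/
theorem IsElementary.factor_eq {n : ℕ} {L : List (ℕ × ℕ)} (h : IsElementary n L) :
    factor n L = signFlip 1 * eval L * signFlip 1 := by
  obtain ⟨hs, -, h1⟩ := h.isShuffle
  rw [factor, h.maj_evalSym]
  split_ifs with hlt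
  · have := (isLift_eval L).signFlip_mul (hs.low 1 le_rfl hlt)
    push_cast at this
    rw [w_eq h.expSum_pos, mul_assoc, this, ← mul_assoc]
  · have := (isLift_eval L).signFlip_mul (p := 1) (q := 1) (h1 (le_antisymm h.2.2 (by omega)))
    push_cast at this
    rw [this, mul_assoc, signFlip_mul_self, mul_one]

theorem prod_factor {n : ℕ} {F : List (List (ℕ × ℕ))} (h : ∀ L ∈ F, IsElementary n L) :
    (F.map (factor n)).prod = signFlip 1 * (F.map eval).prod * signFlip 1 := by
  induction F with
  | nil => simp [signFlip_mul_self]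
  | cons L F ih =>
    simp only [List.map_cons, List.prod_cons]
    rw [ih fun M hM => h M (by simp [hM]), (h L (by simp)).factor_eq]
    simp only [mul_assoc]
    rw [← mul_assoc (signFlip 1) (signFlip 1), signFlip_mul_self, one_mul]

/-! ### The parabolic subgroup as a conjugate of the odd extensions -/

theorem exists_isLift_of_mem_parabolic {n : ℕ} {π : LPerm ℤ} (hπ : π ∈ parabolic n) :
    ∃ b, IsLift (signFlip 1 * π * signFlip 1) b := by
  have hinv : (signFlip 1)⁻¹ = signFlip 1 := inv_eq_of_mul_eq_one_left (signFlip_mul_self 1)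
  induction hπ using Subgroup.closure_induction with
  | mem x hx =>
    rcases hx with hx | ⟨i, hi, -, rfl⟩
    · rw [Set.mem_singleton_iff] at hx
      subst hx
      refine ⟨sSym 1, ?_⟩
      convert isLift_s le_rfl using 1
      refine lperm_ext fun x => ?_
      rw [unop_mul_apply, unop_mul_apply, s_apply le_rfl, sPrime_apply, signFlip_apply,
        signFlip_apply]
      push_cast
      split_ifs <;> first | omega | contradiction
    · have hs := isLift_s (i := i) (by omega)
      have h1 := hs.signFlip_mul (p := 1) (q := 1) (by
        rw [sSym, MulOpposite.unop_op, Equiv.swap_apply_of_ne_of_ne] <;> omega)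
      push_cast at h1
      exact ⟨sSym i, by rwa [h1, mul_assoc, signFlip_mul_self, mul_one]⟩
  | one => exact ⟨1, by simpa [signFlip_mul_self] using isLift_one⟩
  | mul x y _ _ hx hy =>
    obtain ⟨b, hb⟩ := hx
    obtain ⟨c, hc⟩ := hy
    refine ⟨b * c, ?_⟩
    convert hb.mul hc using 1
    simp only [mul_assoc]
    rw [← mul_assoc (signFlip 1) (signFlip 1), signFlip_mul_self, one_mul]
  | inv x _ hx =>
    obtain ⟨b, hb⟩ := hx
    refine ⟨b⁻¹, ?_⟩
    convert hb.inv using 1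
    simp only [mul_inv_rev, hinv, mul_assoc]

/-- Sign changes do not affect absolute values, so the permutation being lifted can only be `π'`. -/
theorem isLift_Phi {n : ℕ} (π : evenSignedGroup n) (hπ : (π : LPerm ℤ) ∈ parabolic n) :
    IsLift (signFlip 1 * π * signFlip 1) (Phi n π : LPerm ℕ) := by
  obtain ⟨b, hb⟩ := exists_isLift_of_mem_parabolic hπ
  convert hb using 1
  refine lperm_ext fun j => ?_
  change ((π : LPerm ℤ).unop (j : ℤ)).natAbs = b.unop j
  have h1 : ∀ x : ℤ, ((signFlip 1).unop x).natAbs = x.natAbs := fun x => by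
    rw [signFlip_apply]
    split_ifs <;> omega
  have h2 := signed_natAbs π.2.1
  have h3 := congrArg Int.natAbs (hb j).1
  rw [unop_mul_apply, unop_mul_apply, h1, ← h2, h1, h2, Int.natAbs_natCast] at h3
  exact h3

theorem eq_prod_factor {n : ℕ} (π : evenSignedGroup n) (hπ : (π : LPerm ℤ) ∈ parabolic n)
    {F : List (List (ℕ × ℕ))} (hF : IsElementaryProduct n (Phi n π) F) :
    (π : LPerm ℤ) = (F.map (factor n)).prod := by
  have h1 := isLift_Phi π hπ
  rw [hF.2.2] at h1
  rw [prod_factor hF.1, ← h1.unique (isLift_list_prod F fun L _ => isLift_eval L)]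
  simp only [mul_assoc]
  rw [signFlip_mul_self, mul_one, ← mul_assoc, signFlip_mul_self, one_mul]

/-! ### Existence of elementary factorizations -/

theorem exists_canonicalForm {n : ℕ} {σ : LPerm ℕ} (hσ : σ ∈ symGroup n) :
    ∃ L, IsCanonicalForm n L ∧ σ = evalSym L := by
  induction n generalizing σ with
  | zero =>
    refine ⟨[], ⟨List.Pairwise.nil, by simp⟩, lperm_ext fun x => ?_⟩
    rw [hσ x (by simp)]
    rfl
  | succ n ih =>
    have hmem : σ.unop (n + 1) ∈ Finset.Icc 1 (n + 1) := by
      by_contra hc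
      have := σ.unop.injective (hσ _ hc)
      rw [this] at hc
      simp at hc
    rw [Finset.mem_Icc] at hmem
    -- `t_{n+1} ^ i` sends `n + 1` to `n + 1 - i`; with this `i`, cancelling it on the right leaves
    -- a permutation that fixes `n + 1`.
    obtain ⟨i, hi⟩ : ∃ i, σ.unop (n + 1) + i = n + 1 := ⟨n + 1 - σ.unop (n + 1), by omega⟩
    have hT := tSym_pow_apply (k := n + 1) (i := i) (by omega) (by omega)
    obtain ⟨L, hL, hL'⟩ := ih (σ := σ * (tSym (n + 1) ^ i)⁻¹) (by
      intro j hj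
      rw [Finset.mem_Icc] at hj
      rw [unop_mul_apply, MulOpposite.unop_inv, Equiv.Perm.inv_eq_iff_eq, hT]
      by_cases hjn : j = n + 1
      · subst hjn
        rw [if_neg (by omega), if_neg (by omega)]
        exact Nat.eq_sub_of_add_eq hi
      · rw [hσ j (by rw [Finset.mem_Icc]; omega), if_pos (by omega)])
    rw [mul_inv_eq_iff_eq_mul] at hL'
    rcases Nat.eq_zero_or_pos i with rfl | hpos
    · refine ⟨L, ⟨hL.1, fun p hp => ?_⟩, by simpa using hL'⟩
      have := hL.2 p hp
      omega
    · refine ⟨L ++ [(n + 1, i)], ⟨?_, ?_⟩, by simpa using hL'⟩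
      · rw [List.pairwise_append]
        refine ⟨hL.1, List.pairwise_singleton _ _, fun p hp q hq => ?_⟩
        have := hL.2 p hp
        rw [List.mem_singleton.mp hq]
        dsimp only
        omega
      · intro p hp
        rcases List.mem_append.mp hp with hp | hp
        · have := hL.2 p hp
          omega
        · rw [List.mem_singleton.mp hp]
          dsimp only
          omega

theorem IsElementary.cons {n : ℕ} {p : ℕ × ℕ} {L : List (ℕ × ℕ)} (hL : IsElementary n L)
    (hp : 2 ≤ p.1 ∧ p.1 ≤ n ∧ 0 < p.2 ∧ p.2 < p.1) (h : p.1 < firstIdx L)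
    (hle : p.2 + expSum L ≤ p.1) : IsElementary n (p :: L) := by
  refine ⟨by simp, ⟨List.pairwise_cons.mpr ⟨fun q hq => ?_, hL.2.1.1⟩, ?_⟩, by simpa using hle⟩
  · exact h.trans_le (hL.2.1.firstIdx_le hq)
  · intro q hq
    rcases List.mem_cons.mp hq with rfl | hq
    · exact hp
    · exact hL.2.1.2 q hq

theorem isElementary_singleton {n : ℕ} {p : ℕ × ℕ}
    (hp : 2 ≤ p.1 ∧ p.1 ≤ n ∧ 0 < p.2 ∧ p.2 < p.1) : IsElementary n [p] :=
  ⟨by simp, ⟨List.pairwise_singleton _ _, by simpa using hp⟩, by simpa using hp.2.2.2.le⟩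

/-- Consecutive factors `L`, `M` of an elementary factorization satisfy
`lastIdx L ≤ expSum M`. -/
def Linked (L M : List (ℕ × ℕ)) : Prop := lastIdx L ≤ expSum M

theorem isElementaryProduct_iff {n : ℕ} {σ : LPerm ℕ} {F : List (List (ℕ × ℕ))} :
    IsElementaryProduct n σ F ↔
      (∀ L ∈ F, IsElementary n L) ∧ F.IsChain Linked ∧ σ = (F.map evalSym).prod := by
  rw [IsElementaryProduct, List.isChain_iff_getElem]
  rfl

/-- Greedy construction from the right: a new letter joins the leading factor while the exponent sum
allows it. The last clause keeps the first index of the leading factor above the next letter; it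
ranges over `head?` because `F` may be empty. -/
theorem IsCanonicalForm.exists_factorization {n : ℕ} {L : List (ℕ × ℕ)}
    (hL : IsCanonicalForm n L) :
    ∃ F : List (List (ℕ × ℕ)), ((∀ M ∈ F, IsElementary n M) ∧ F.IsChain Linked ∧
        evalSym L = (F.map evalSym).prod) ∧
      ∀ k, (∀ p ∈ L, k < p.1) → ∀ M ∈ F.head?, k < firstIdx M := by
  induction L with
  | nil => exact ⟨[], by simp⟩
  | cons p L ih =>
    obtain ⟨F, ⟨h1, h2, h3⟩, h4⟩ := ih hL.tail
    have hp := hL.2 p (by simp)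
    have hlt := h4 p.1 (List.pairwise_cons.mp hL.1).1
    cases F with
    | nil =>
      refine ⟨[[p]], ⟨by simpa using isElementary_singleton hp, by simp, by simp_all⟩, ?_⟩
      intro k hk M hM
      simp only [List.head?_cons, Option.mem_some_iff] at hM
      subst hM
      exact hk p (by simp)
    | cons M F =>
      have hM := hlt M rfl
      have hMe := h1 M (by simp)
      have hF : ∀ N ∈ F, IsElementary n N := fun N hN => h1 N (by simp [hN])
      rw [List.map_cons, List.prod_cons] at h3
      -- A letter put in front of `M` leaves its last index, hence its outgoing link, unchanged.
      have chain : ∀ q : ℕ × ℕ, ((q :: M) :: F).IsChain Linked := fun q => by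
        cases F with
        | nil => simp
        | cons N F =>
          rw [List.isChain_cons_cons] at h2 ⊢
          refine ⟨?_, h2.2⟩
          have h5 := h2.1
          obtain ⟨r, M, rfl⟩ := List.exists_cons_of_ne_nil hMe.1
          simpa [Linked, lastIdx] using h5
      rcases le_or_gt (p.2 + expSum M) p.1 with hc | hc
      · refine ⟨(p :: M) :: F, ⟨?_, chain p, by simp [h3, mul_assoc]⟩, ?_⟩
        · rw [List.forall_mem_cons]
          exact ⟨hMe.cons hp hM hc, hF⟩
        · intro k hk N hN
          simp only [List.head?_cons, Option.mem_some_iff] at hN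
          subst hN
          exact hk p (by simp)
      · rcases le_or_gt p.1 (expSum M) with hc' | hc'
        · refine ⟨[p] :: M :: F, ⟨?_, ?_, by simp [h3]⟩, ?_⟩
          · rw [List.forall_mem_cons]
            exact ⟨isElementary_singleton hp, h1⟩
          · rw [List.isChain_cons_cons]
            exact ⟨by simpa [Linked, lastIdx] using hc', h2⟩
          · intro k hk N hN
            simp only [List.head?_cons, Option.mem_some_iff] at hN
            subst hN
            exact hk p (by simp)
        -- The power is split: one part raises the exponent sum of `M` to exactly `p.1`, which is
        -- both the maximum allowed and the minimum needed to link with the remaining part.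
        · refine ⟨[(p.1, p.2 - (p.1 - expSum M))] :: ((p.1, p.1 - expSum M) :: M) :: F,
            ⟨?_, ?_, ?_⟩, ?_⟩
          · have := hMe.expSum_pos
            rw [List.forall_mem_cons, List.forall_mem_cons]
            refine ⟨isElementary_singleton ?_, hMe.cons ?_ hM ?_, hF⟩ <;> dsimp only <;> omega
          · rw [List.isChain_cons_cons]
            refine ⟨?_, chain _⟩
            simp only [Linked, lastIdx, expSum_cons, List.getLastD_cons, List.getLastD_nil]
            omega
          · simp only [evalSym_cons, h3, List.map_cons, List.prod_cons, evalSym_nil, mul_one,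
              ← mul_assoc, ← pow_add]
            rw [Nat.sub_add_cancel (by omega)]
          · intro k hk N hN
            simp only [List.head?_cons, Option.mem_some_iff] at hN
            subst hN
            exact hk p (by simp)

theorem exists_isStandardFactorization {n : ℕ} {σ : LPerm ℕ} (hσ : σ ∈ symGroup n) :
    ∃ F, IsStandardFactorization n σ F := by
  classical
  obtain ⟨L, hL, rfl⟩ := exists_canonicalForm hσ
  obtain ⟨F, hF, -⟩ := hL.exists_factorization
  have hex : ∃ m F, IsElementaryProduct n (evalSym L) F ∧ F.length = m :=
    ⟨_, F, isElementaryProduct_iff.mpr hF, rfl⟩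
  obtain ⟨G, hG, hG'⟩ := Nat.find_spec hex
  exact ⟨G, hG, fun H hH => hG'.trans_le (Nat.find_min' hex ⟨H, hH, rfl⟩)⟩

/-! ### Exponents of a single letter -/

/-- The total exponent of the index `k` in `L`. -/
def idxExp (L : List (ℕ × ℕ)) (k : ℕ) : ℕ := expSum (L.filter fun p => p.1 = k)

theorem idxExp_cons (p : ℕ × ℕ) (L : List (ℕ × ℕ)) (k : ℕ) :
    idxExp (p :: L) k = (if p.1 = k then p.2 else 0) + idxExp L k := by
  unfold idxExp
  rw [List.filter_cons]
  split_ifs <;> simp_all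

theorem idxExp_eq_zero {L : List (ℕ × ℕ)} {k : ℕ} (h : ∀ p ∈ L, p.1 ≠ k) : idxExp L k = 0 := by
  unfold idxExp
  rw [List.filter_eq_nil_iff.mpr (by simpa using h), expSum_nil]

theorem IsCanonicalForm.idxExp_eq {n : ℕ} {L : List (ℕ × ℕ)} (h : IsCanonicalForm n L)
    {p : ℕ × ℕ} (hp : p ∈ L) : idxExp L p.1 = p.2 := by
  induction L with
  | nil => simp at hp
  | cons q L ih =>
    have hq := (List.pairwise_cons.mp h.1).1
    rw [idxExp_cons]
    rcases List.mem_cons.mp hp with rfl | hp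
    · rw [if_pos rfl, idxExp_eq_zero fun r hr => (hq r hr).ne', add_zero]
    · rw [if_neg (hq p hp).ne, ih h.tail hp, zero_add]

theorem IsCanonicalForm.idxExp_lt {n : ℕ} {L : List (ℕ × ℕ)} (h : IsCanonicalForm n L)
    {k : ℕ} (hk : 0 < k) : idxExp L k < k := by
  by_cases hex : ∃ p ∈ L, p.1 = k
  · obtain ⟨p, hp, rfl⟩ := hex
    rw [h.idxExp_eq hp]
    exact (h.2 p hp).2.2.2
  · rw [idxExp_eq_zero fun p hp hpk => hex ⟨p, hp, hpk⟩]
    exact hk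

@[simp] theorem tExp_nil (k : ℕ) : tExp [] k = 0 := rfl

theorem tExp_cons (L : List (ℕ × ℕ)) (F : List (List (ℕ × ℕ))) (k : ℕ) :
    tExp (L :: F) k = idxExp L k + tExp F k := by
  simp [tExp, idxExp]

theorem tExp_eq_zero {F : List (List (ℕ × ℕ))} {k : ℕ} (h : ∀ L ∈ F, ∀ p ∈ L, p.1 ≠ k) :
    tExp F k = 0 := by
  refine idxExp_eq_zero fun p hp => ?_
  obtain ⟨L, hL, hp⟩ := List.mem_flatten.mp hp
  exact h L hL p hp

theorem wExp_cons (n : ℕ) (L : List (ℕ × ℕ)) (F : List (List (ℕ × ℕ))) (k : ℕ) :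
    wExp n (L :: F) k =
      (if maj n (evalSym L) = k ∧ k < firstIdx L then 1 else 0) + wExp n F k := by
  rw [wExp, List.countP_cons, add_comm]
  simp [wExp]

section

variable {n : ℕ} {L : List (ℕ × ℕ)} {F : List (List (ℕ × ℕ))}

/-- Links compose: `lastIdx L ≤ expSum M < lastIdx M ≤ expSum N`. -/
theorem pairwise_of_isChain (h : ∀ L ∈ F, IsElementary n L) (hc : F.IsChain Linked) :
    F.Pairwise Linked := by
  induction F with
  | nil => exact List.Pairwise.nil
  | cons L F ih =>
    have hF : ∀ M ∈ F, IsElementary n M := fun M hM => h M (by simp [hM])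
    have ih' := ih hF hc.tail
    refine List.pairwise_cons.mpr ⟨?_, ih'⟩
    cases F with
    | nil => simp
    | cons M F =>
      have hLM := (List.isChain_cons_cons.mp hc).1
      intro N hN
      rcases List.mem_cons.mp hN with rfl | hN
      · exact hLM
      · have hMN := (List.pairwise_cons.mp ih').1 N hN
        have := (hF M (by simp)).expSum_lt_lastIdx
        unfold Linked at *
        omega

/-- Every index in a later factor `M` is at least `firstIdx M ≥ expSum M ≥ lastIdx L`. -/
theorem tExp_eq_zero_of_lt (h : ∀ M ∈ F, IsElementary n M) (hL : ∀ M ∈ F, Linked L M) {k : ℕ}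
    (hk : k < lastIdx L) : tExp F k = 0 := by
  refine tExp_eq_zero fun M hM p hp => ?_
  have h1 := (h M hM).2.1.firstIdx_le hp
  have h2 := (h M hM).2.2
  have h3 : lastIdx L ≤ expSum M := hL M hM
  omega

theorem wExp_eq_zero_of_lt (h : ∀ M ∈ F, IsElementary n M) (hL : ∀ M ∈ F, Linked L M) {k : ℕ}
    (hk : k < lastIdx L) : wExp n F k = 0 := by
  refine List.countP_eq_zero.mpr fun M hM => ?_
  have h3 : lastIdx L ≤ expSum M := hL M hM
  rw [(h M hM).maj_evalSym, decide_eq_true_eq]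
  omega

theorem wExp_le_one (h : ∀ L ∈ F, IsElementary n L) (hF : F.Pairwise Linked) (k : ℕ) :
    wExp n F k ≤ 1 := by
  induction F with
  | nil => simp [wExp]
  | cons L F ih =>
    have h' : ∀ M ∈ F, IsElementary n M := fun M hM => h M (by simp [hM])
    obtain ⟨h1, h2⟩ := List.pairwise_cons.mp hF
    rw [wExp_cons]
    split_ifs with hc
    · have := (h L (by simp)).firstIdx_le_lastIdx
      rw [wExp_eq_zero_of_lt h' h1 (by omega)]
    · rw [zero_add]
      exact ih h' h2

/-! ### Factorizations with no cancelling neighbours -/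

/-- If the last letter of `L` and the first letter of `M` are powers of the same `t_k`, then the
sum of their exponents is smaller than `k`. -/
def Reduced (L M : List (ℕ × ℕ)) : Prop :=
  lastIdx L = firstIdx M → (L.getLastD (0, 0)).2 + (M.headD (0, 0)).2 < lastIdx L

/-- Only neighbours can share `t_k`, as last letter of one and first letter of the next; the bound
for that case is `Reduced`. -/
theorem tExp_lt (h : ∀ L ∈ F, IsElementary n L) (hF : F.Pairwise Linked)
    (hR : F.IsChain Reduced) {k : ℕ} (hk : 0 < k) : tExp F k < k := by
  induction F with
  | nil => simpa using hk
  | cons L F ih =>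
    have h' : ∀ M ∈ F, IsElementary n M := fun M hM => h M (by simp [hM])
    have hL := h L (by simp)
    obtain ⟨h1, h2⟩ := List.pairwise_cons.mp hF
    rw [tExp_cons]
    rcases lt_trichotomy k (lastIdx L) with hlt | heq | hgt
    · rw [tExp_eq_zero_of_lt h' h1 hlt, add_zero]
      exact hL.2.1.idxExp_lt hk
    · cases F with
      | nil => simpa using hL.2.1.idxExp_lt hk
      | cons M F =>
        have hM := h' M (by simp)
        have hLM : lastIdx L ≤ expSum M := h1 M (by simp)
        have h3 : tExp F k = 0 := by
          refine tExp_eq_zero_of_lt (fun N hN => h' N (by simp [hN])) (List.pairwise_cons.mp h2).1 ?_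
          have := hM.expSum_lt_lastIdx
          omega
        rw [tExp_cons, h3, add_zero]
        by_cases hf : lastIdx L = firstIdx M
        · have hr := (List.isChain_cons_cons.mp hR).1 hf
          have e1 : idxExp L k = (L.getLastD (0, 0)).2 := by
            rw [heq]
            refine hL.2.1.idxExp_eq ?_
            rw [List.getLastD_eq_getLast?, List.getLast?_eq_getLast_of_ne_nil hL.1]
            exact List.getLast_mem hL.1
          have e2 : idxExp M k = (M.headD (0, 0)).2 := by
            rw [heq, hf]
            refine hM.2.1.idxExp_eq ?_
            obtain ⟨q, M, rfl⟩ := List.exists_cons_of_ne_nil hM.1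
            simp
          omega
        -- Here `lastIdx L ≤ expSum M ≤ firstIdx M` and the ends differ, so `M` starts beyond `k`.
        · rw [idxExp_eq_zero (L := M), add_zero]
          · exact hL.2.1.idxExp_lt hk
          · intro p hp
            have := hM.2.1.firstIdx_le hp
            have := hM.2.2
            omega
    · rw [idxExp_eq_zero (L := L), zero_add]
      · exact ih h' h2 hR.tail
      · intro p hp
        have := hL.2.1.le_lastIdx hp
        omega

end

/-- Neighbouring elementary factors that are not reduced merge into one elementary factor. -/
theorem exists_merge {n : ℕ} {L M : List (ℕ × ℕ)} (hL : IsElementary n L) (hM : IsElementary n M)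
    (hLM : Linked L M) (hR : ¬ Reduced L M) :
    ∃ N, IsElementary n N ∧ evalSym N = evalSym L * evalSym M ∧ expSum N = expSum L ∧
      lastIdx N = lastIdx M := by
  obtain ⟨A, ⟨k, i⟩, rfl⟩ : ∃ A p, L = A ++ [p] := by
    rcases List.eq_nil_or_concat L with h | ⟨A, p, h⟩
    · exact absurd h hL.1
    · exact ⟨A, p, by simpa using h⟩
  obtain ⟨⟨k', i'⟩, B, rfl⟩ := List.exists_cons_of_ne_nil hM.1
  simp only [Reduced, lastIdx, firstIdx_cons, List.getLastD_concat, List.headD_cons,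
    Classical.not_imp, not_lt] at hR
  obtain ⟨rfl, hge⟩ := hR
  obtain ⟨-, ⟨hLp, hLb⟩, hLe⟩ := hL
  obtain ⟨-, ⟨hMp, hMb⟩, hMe⟩ := hM
  simp only [Linked, lastIdx, List.getLastD_concat, expSum_cons, expSum_append, expSum_nil,
    firstIdx_cons] at hLM hLe hMe ⊢
  have hi := hLb (k, i) (by simp)
  have hi' := hMb (k, i') (by simp)
  rw [List.pairwise_append] at hLp
  rw [List.pairwise_cons] at hMp
  have hA : ∀ p ∈ A, p.1 < k := fun p hp => hLp.2.2 p hp (k, i) (by simp)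
  have hB : ∀ p ∈ B, k < p.1 := fun p hp => hMp.1 p hp
  -- The link and the shared letter force the exponent sum of `M` to be exactly `k`; as `i' < k`,
  -- further letters must follow.
  obtain ⟨q, B, rfl⟩ : ∃ q C, B = q :: C := by
    cases B with
    | nil => simp only [expSum_nil] at hLM; dsimp only at hi'; omega
    | cons q C => exact ⟨q, C, rfl⟩
  have hq := hB q (by simp)
  have hkk : tSym k ^ i * tSym k ^ i' = tSym k ^ (i + i' - k) := by
    rw [← pow_add]
    conv_lhs => rw [← Nat.sub_add_cancel hge, pow_add, tSym_pow_self (by omega), mul_one]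
  have hlast : ∀ C : List (ℕ × ℕ), ((C ++ q :: B).getLastD (0, 0)).1 =
      (((k, i') :: q :: B).getLastD (0, 0)).1 := fun C => by
    simp [List.getLastD_eq_getLast?, List.getLast?_append, List.getLast?_cons]
  -- Since `t_k ^ k = 1`, the shared letter vanishes or keeps the exponent `i + i' - k`. The `k`
  -- lost is the exponent sum of `M`, so that of `L` remains.
  rcases hge.eq_or_lt with heq | hlt
  · refine ⟨A ++ q :: B, ⟨by simp, ⟨?_, ?_⟩, ?_⟩, ?_, ?_, hlast A⟩
    · rw [List.pairwise_append]
      exact ⟨hLp.1, hMp.2, fun a ha b hb => (hA a ha).trans (hB b hb)⟩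
    · intro p hp
      rcases List.mem_append.mp hp with hp | hp
      · exact hLb p (by simp [hp])
      · exact hMb p (List.mem_cons_of_mem _ hp)
    · cases A with
      | nil =>
        simp only [List.nil_append, firstIdx_cons, expSum_cons, expSum_nil] at *
        omega
      | cons a A =>
        simp only [List.cons_append, firstIdx_cons, expSum_cons, expSum_append] at *
        omega
    · rw [← heq, Nat.sub_self, pow_zero] at hkk
      simp only [evalSym_append, evalSym_cons, evalSym_nil, mul_one]
      simp only [mul_assoc]
      rw [← mul_assoc (tSym k ^ i), hkk, one_mul]
    · simp only [expSum_append, expSum_cons] at *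
      omega
  · refine ⟨A ++ (k, i + i' - k) :: q :: B, ⟨by simp, ⟨?_, ?_⟩, ?_⟩, ?_, ?_, ?_⟩
    · rw [List.pairwise_append, List.pairwise_cons]
      refine ⟨hLp.1, ⟨hB, hMp.2⟩, fun a ha b hb => ?_⟩
      rcases List.mem_cons.mp hb with rfl | hb
      · exact hA a ha
      · exact (hA a ha).trans (hB b hb)
    · intro p hp
      rcases List.mem_append.mp hp with hp | hp
      · exact hLb p (by simp [hp])
      · rcases List.mem_cons.mp hp with rfl | hp
        · dsimp only at *
          omega
        · exact hMb p (List.mem_cons_of_mem _ hp)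
    · cases A with
      | nil =>
        simp only [List.nil_append, firstIdx_cons, expSum_cons, expSum_nil] at *
        omega
      | cons a A =>
        simp only [List.cons_append, firstIdx_cons, expSum_cons, expSum_append] at *
        omega
    · simp only [evalSym_append, evalSym_cons, evalSym_nil, mul_one]
      rw [← hkk]
      simp only [mul_assoc]
    · simp only [expSum_append, expSum_cons] at *
      omega
    · have := hlast (A ++ [(k, i + i' - k)])
      simpa using this

/-- A property of consecutive members that holds at every splitting holds along the list. -/
theorem isChain_of_split {α : Type} {R : α → α → Prop} {l : List α}
    (h : ∀ A B x y, l = A ++ x :: y :: B → R x y) : l.IsChain R := by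
  induction l with
  | nil => exact List.IsChain.nil
  | cons x l ih =>
    have ih' := ih fun A B a b hl => h (x :: A) B a b (by rw [hl]; rfl)
    cases l with
    | nil => simp
    | cons y l => exact List.isChain_cons_cons.mpr ⟨h [] l x y rfl, ih'⟩

/-- The incoming link sees only the exponent sum, the outgoing one only the last index. -/
theorem isChain_merge {F G : List (List (ℕ × ℕ))} {L M N : List (ℕ × ℕ)}
    (h : (F ++ L :: M :: G).IsChain Linked) (he : expSum N = expSum L)
    (hl : lastIdx N = lastIdx M) : (F ++ N :: G).IsChain Linked := by
  rw [List.isChain_append] at h ⊢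
  obtain ⟨h1, h2, h3⟩ := h
  refine ⟨h1, ?_, ?_⟩
  · have h4 := (List.isChain_cons_cons.mp h2).2
    cases G with
    | nil => simp
    | cons K G =>
      rw [List.isChain_cons_cons] at h4 ⊢
      exact ⟨by simpa only [Linked, hl] using h4.1, h4.2⟩
  · simp only [List.head?_cons, Option.mem_some_iff, forall_eq', Linked, he] at h3 ⊢
    exact h3

/-- The one place where minimality enters: a merge would shorten the factorization. -/
theorem IsStandardFactorization.isChain_reduced {n : ℕ} {σ : LPerm ℕ}
    {F : List (List (ℕ × ℕ))} (h : IsStandardFactorization n σ F) : F.IsChain Reduced := by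
  obtain ⟨h1, hmin⟩ := h
  obtain ⟨he, hc, hσ⟩ := isElementaryProduct_iff.mp h1
  refine isChain_of_split fun A B L M hF => ?_
  subst hF
  by_contra hR
  have hLM := (List.isChain_cons_cons.mp (List.isChain_append.mp hc).2.1).1
  obtain ⟨N, hN, h2, h3, h4⟩ := exists_merge (he L (by simp)) (he M (by simp)) hLM hR
  have := hmin (A ++ N :: B) (isElementaryProduct_iff.mpr ⟨?_, isChain_merge hc h3 h4, ?_⟩)
  · simp only [List.length_append, List.length_cons] at this
    omega
  · intro K hK
    rcases List.mem_append.mp hK with hK | hK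
    · exact he K (by simp [hK])
    · rcases List.mem_cons.mp hK with rfl | hK
      · exact hN
      · exact he K (by simp [hK])
  · rw [hσ]
    simp [h2, mul_assoc]

/-! ### The generalized standard presentation -/

/-- `w_a^{j_a} t_{a+1}^{i_{a+1}} ⋯ w_{a+N-1}^{j_{a+N-1}} t_{a+N}^{i_{a+N}}`. -/
def ogsProd (i j : ℕ → ℕ) : ℕ → ℕ → LPerm ℤ
  | _, 0 => 1
  | a, N + 1 => w a ^ j a * t (a + 1) ^ i (a + 1) * ogsProd i j (a + 1) N

theorem ogsProd_eq (i j : ℕ → ℕ) (a N : ℕ) :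
    ogsProd i j a N =
      ((List.range N).map fun r => w (r + a) ^ j (r + a) * t (r + a + 1) ^ i (r + a + 1)).prod := by
  induction N generalizing a with
  | zero => rfl
  | succ N ih =>
    rw [ogsProd, ih, List.range_succ_eq_map, List.map_cons, List.prod_cons, List.map_map,
      Nat.zero_add]
    congr 2
    refine List.map_congr_left fun r _ => ?_
    simp only [Function.comp_apply, Nat.succ_eq_add_one, add_right_comm r 1 a, ← add_assoc]

theorem ogsProd_congr {i i' j j' : ℕ → ℕ} {a : ℕ} (N : ℕ) (hi : ∀ r, a < r → i r = i' r)
    (hj : ∀ r, a ≤ r → j r = j' r) : ogsProd i j a N = ogsProd i' j' a N := by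
  induction N generalizing a with
  | zero => rfl
  | succ N ih =>
    rw [ogsProd, ogsProd, hj a le_rfl, hi (a + 1) (by omega),
      ih (fun r hr => hi r (by omega)) fun r hr => hj r (by omega)]

theorem ogsProd_zero (a N : ℕ) : ogsProd (fun _ => 0) (fun _ => 0) a N = 1 := by
  induction N generalizing a with
  | zero => rfl
  | succ N ih => simp [ogsProd, ih]

/-- Everything standing before `t_k` in the product is trivial, so the power is absorbed without any
commutation. -/
theorem t_pow_mul_ogsProd {i j : ℕ → ℕ} {a N k : ℕ} (e : ℕ) (h1 : a < k) (h2 : k ≤ a + N)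
    (hi : ∀ r < k, i r = 0) (hj : ∀ r < k, j r = 0) :
    t k ^ e * ogsProd i j a N = ogsProd (fun r => (if k = r then e else 0) + i r) j a N := by
  induction N generalizing a with
  | zero => omega
  | succ N ih =>
    rw [ogsProd, ogsProd, hj a h1]
    by_cases hk : k = a + 1
    · subst hk
      simp only [pow_zero, one_mul, if_true]
      rw [← mul_assoc, ← pow_add]
      congr 1
      refine ogsProd_congr N (fun r hr => ?_) fun _ _ => rfl
      rw [if_neg (by omega), zero_add]
    · simp only [hi (a + 1) (by omega), if_neg hk, pow_zero, one_mul, add_zero]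
      exact ih (by omega) (by omega)

theorem w_mul_ogsProd {i j : ℕ → ℕ} {a N m : ℕ} (h1 : a ≤ m) (h2 : m < a + N)
    (hi : ∀ r ≤ m, i r = 0) (hj : ∀ r < m, j r = 0) :
    w m * ogsProd i j a N = ogsProd i (fun r => (if m = r then 1 else 0) + j r) a N := by
  induction N generalizing a with
  | zero => omega
  | succ N ih =>
    rw [ogsProd, ogsProd]
    by_cases hm : m = a
    · subst hm
      simp only [if_true, pow_add, pow_one, mul_assoc]
      congr 3
      refine ogsProd_congr N (fun _ _ => rfl) fun r hr => ?_
      rw [if_neg (by omega), zero_add]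
    · simp only [hi (a + 1) (by omega), hj a (by omega), if_neg hm, pow_zero, one_mul, add_zero]
      exact ih (by omega) (by omega)

theorem eval_mul_ogsProd {n a N : ℕ} {i j : ℕ → ℕ} {L : List (ℕ × ℕ)} (hL : IsCanonicalForm n L)
    (hr : ∀ p ∈ L, a < p.1 ∧ p.1 ≤ a + N) (hi : ∀ r < lastIdx L, i r = 0)
    (hj : ∀ r < lastIdx L, j r = 0) :
    eval L * ogsProd i j a N = ogsProd (fun r => idxExp L r + i r) j a N := by
  -- The vanishing is restated letter by letter, a form that passes to the tail in the induction.
  have hi' : ∀ p ∈ L, ∀ r < p.1, i r = 0 := fun p hp r hr =>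
    hi r (hr.trans_le (hL.le_lastIdx hp))
  have hj' : ∀ p ∈ L, ∀ r < p.1, j r = 0 := fun p hp r hr =>
    hj r (hr.trans_le (hL.le_lastIdx hp))
  clear hi hj
  induction L with
  | nil => simp [eval, idxExp]
  | cons p L ih =>
    have : eval (p :: L) = t p.1 ^ p.2 * eval L := by simp [eval]
    have hp := hr p (by simp)
    rw [this, mul_assoc, ih hL.tail (fun q hq => hr q (by simp [hq]))
        (fun q hq => hi' q (by simp [hq])) (fun q hq => hj' q (by simp [hq])),
      t_pow_mul_ogsProd p.2 hp.1 hp.2 ?_ (hj' p (by simp))]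
    · simp only [idxExp_cons, add_assoc]
    · intro r hr
      rw [hi' p (by simp) r hr, idxExp_eq_zero]
      intro q hq
      have := (List.pairwise_cons.mp hL.1).1 q hq
      omega

/-- The first factor is absorbed from the left into the product of the others, whose exponents
vanish below `lastIdx L`: first its powers of `t_k`, then `w_e`, which precedes them because `e <
firstIdx L`. -/
theorem prod_factor_eq_ogsProd {n : ℕ} {F : List (List (ℕ × ℕ))}
    (h : ∀ L ∈ F, IsElementary n L) (hF : F.Pairwise Linked) :
    (F.map (factor n)).prod = ogsProd (tExp F) (wExp n F) 1 (n - 1) := by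
  induction F with
  | nil => exact (ogsProd_zero 1 (n - 1)).symm
  | cons L F ih =>
    have h' : ∀ M ∈ F, IsElementary n M := fun M hM => h M (by simp [hM])
    have hL := h L (by simp)
    obtain ⟨h1, h2⟩ := List.pairwise_cons.mp hF
    have hz : ∀ r < lastIdx L, tExp F r = 0 := fun r hr => tExp_eq_zero_of_lt h' h1 hr
    have hz' : ∀ r < lastIdx L, wExp n F r = 0 := fun r hr => wExp_eq_zero_of_lt h' h1 hr
    have he := eval_mul_ogsProd (a := 1) (N := n - 1) hL.2.1
      (fun p hp => by have := hL.2.1.2 p hp; omega) hz hz'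
    rw [List.map_cons, List.prod_cons, ih h' h2, factor]
    simp only [← tExp_cons] at he
    have b1 := hL.expSum_pos
    have b2 := hL.expSum_lt_lastIdx
    have b3 := hL.lastIdx_le
    split_ifs with hlt
    · rw [mul_assoc, he, hL.maj_evalSym, w_mul_ogsProd b1 (by omega)]
      · refine ogsProd_congr _ (fun _ _ => rfl) fun r _ => ?_
        rw [hL.maj_evalSym] at hlt
        rw [wExp_cons, hL.maj_evalSym]
        congr 1
        refine if_congr ⟨fun hr => ⟨hr, hr ▸ hlt⟩, And.left⟩ rfl rfl
      · intro r hr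
        rw [tExp_cons, hz r (by omega), idxExp_eq_zero]
        intro p hp
        have := hL.2.1.firstIdx_le hp
        rw [hL.maj_evalSym] at hlt
        omega
      · exact fun r hr => hz' r (by omega)
    · rw [he]
      refine ogsProd_congr _ (fun _ _ => rfl) fun r _ => ?_
      rw [wExp_cons, if_neg, zero_add]
      rintro ⟨rfl, hc⟩
      exact hlt hc

end StandardOGS

theorem mainTheorem10 (n : ℕ) (hn : 2 ≤ n) (π : StandardOGS.evenSignedGroup n)
    (hπ : (π : StandardOGS.LPerm ℤ) ∈ StandardOGS.parabolic n) :
    (∃ F, StandardOGS.IsStandardFactorization n (StandardOGS.Phi n π) F) ∧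
    ∀ F, StandardOGS.IsStandardFactorization n (StandardOGS.Phi n π) F →
      (∀ L ∈ F, StandardOGS.maj n (StandardOGS.evalSym L) ≤ StandardOGS.firstIdx L) ∧
      (π : StandardOGS.LPerm ℤ) = (F.map (StandardOGS.factor n)).prod ∧
      StandardOGS.IsGeneralizedOGS n (StandardOGS.tExp F) (StandardOGS.wExp n F) π := by
  refine ⟨StandardOGS.exists_isStandardFactorization (StandardOGS.Phi n π).2, fun F hF => ?_⟩
  obtain ⟨he, hc, -⟩ := StandardOGS.isElementaryProduct_iff.mp hF.1
  have hp := StandardOGS.pairwise_of_isChain he hc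
  have hπF := StandardOGS.eq_prod_factor π hπ hF.1
  refine ⟨fun L hL => ?_, hπF, fun k hk _ => ?_, fun k _ _ => StandardOGS.wExp_le_one he hp k, ?_⟩
  · rw [(he L hL).maj_evalSym]
    exact (he L hL).2.2
  · exact Nat.le_sub_one_of_lt (StandardOGS.tExp_lt he hp hF.isChain_reduced (by omega))
  · rw [hπF, StandardOGS.prod_factor_eq_ogsProd he hp, StandardOGS.ogsProd_eq]
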